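/- **Homogeneous Ribbon filter.** Let $n,m,w,r\in\mathbb N$ with $w\le m$. A hash value is a pair $a=(s,c)$ of a starting position $s\in\{1,\dots,m-w+1\}$ and a coefficient vector $c\in\{0,1\}^w$; it determines the row vector $\vec a=0^{s-1}\,c\,0^{m-s-w+1}\in\{0,1\}^m$ over the two-element field. Each of the $n$ keys receives an independent, uniformly distributed hash value; let $\vec h_1,\dots,\vec h_n$ be the resulting row vectors. Given these, the filter stores a matrix $Z\in\{0,1\}^{m\times r}$ chosen uniformly at random among all solutions of the homogeneous system $\vec h_i\cdot Z=0^r$ $(1\le i\le n)$. A query for an element with hash value $a$ is positive iff $\vec a\cdot Z=0^r$. The false positive rate is $f=\mathbb E[f_Z]$, where $f_Z=\Pr_a[\vec a\cdot Z=0^r]$ for an independent uniformly random hash value $a$. The space usage is $\mathrm{space}=mr/n$ bits per key, the information-theoretic optimum is $\mathrm{opt}=-\log_2 f$ bits per key, and the space overhead is $\mathrm{space}/\mathrm{opt}-1$. The filter with $n$ keys and parameters $\varepsilon,w,r$ is the one with $m=(1+\varepsilon)n$. **Theorem.** There is a constant $C>0$ such that the following holds for every real $\varepsilon<1/2$, every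 desired false positive rate $\varphi>0$ and every integer $r\ge 0$ closest to $-\log_2\varphi$ ($r\ge 0$ is automatic when $\varphi\le 1$). For every $w\in\mathbb N$ with $\varepsilon w>C\max(\log w,r)$ and every $n\in\mathbb N$ such that $m=(1+\varepsilon)n$ is an integer with $m\ge w$, the Homogeneous Ribbon filter with $n$ keys and parameters $\varepsilon,w,r$ has false positive rate $$f\in[\varphi/2,\,2\varphi],$$ and, if $r\ge 1$, then $\mathrm{opt}>0$ and its space overhead is at most $2\varepsilon$. (For $r=0$ the filter uses no space and $f=1$, so $\mathrm{opt}=0$ and the overhead is not defined.) Here $C$ depends on none of $\varepsilon,\varphi,r,w,n$. -/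

import Mathlib

open scoped BigOperators

namespace Ribbon

/-- The hash value of a key for a system with `m` columns and ribbon width `w`: a starting
position `s` (zero-based, so `s` ranges over the `m - w + 1` positions with `s + w ≤ m`) and a
coefficient vector `c` in `{0,1}^w`. -/
abbrev HashValue (m w : ℕ) : Type := Fin (m + 1 - w) × (Fin w → ZMod 2)

/-- The row vector `0^s c 0^(m-s-w)` in `{0,1}^m` determined by a hash value. -/
def row {m w : ℕ} (a : HashValue m w) : Fin m → ZMod 2 := fun j =>
  if h : (a.1 : ℕ) ≤ j ∧ (j : ℕ) < a.1 + w then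
    a.2 ⟨j - a.1, Nat.sub_lt_left_of_lt_add h.1 h.2⟩
  else 0

/-- The query result: the product of the row vector of a hash value with `Z`, i.e. the bitwise
exclusive-or of the rows of `Z` selected by the hash value. -/
def query {m w r : ℕ} (a : HashValue m w) (Z : Matrix (Fin m) (Fin r) (ZMod 2)) :
    Fin r → ZMod 2 :=
  Matrix.vecMul (row a) Z

/-- The solutions `Z` of the homogeneous system with one equation for each of the `n` keys, where
`h x` is the hash value of key `x`. -/
def solutions {n m w : ℕ} (r : ℕ) (h : Fin n → HashValue m w) :
    Finset (Matrix (Fin m) (Fin r) (ZMod 2)) :=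
  Finset.univ.filter fun Z => ∀ x, query (h x) Z = 0

/-- The false positive rate of a fixed `Z`: the probability that a query with a uniformly random
hash value (uniform starting position, uniform coefficient vector) returns `0`. -/
noncomputable def fpRateOf {m r : ℕ} (w : ℕ) (Z : Matrix (Fin m) (Fin r) (ZMod 2)) : ℝ :=
  𝔼 a : HashValue m w, if query a Z = 0 then 1 else 0

/-- The false positive rate of the Homogeneous Ribbon filter with `n` keys, `m` rows of `r` bits
and ribbon width `w`: the expectation of `fpRateOf w Z`, where the hash values of the keys are
independent and uniform and, given these, `Z` is a uniformly random solution. -/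
noncomputable def fpRate (n m w r : ℕ) : ℝ :=
  𝔼 h : Fin n → HashValue m w, 𝔼 Z ∈ solutions r h, fpRateOf w Z

/-- The space usage in bits per key: `m * r` bits are stored for `n` keys. -/
noncomputable def spacePerKey (n m r : ℕ) : ℝ := (m * r : ℝ) / n

/-- The information-theoretic lower bound, in bits per key, for the false positive rate `f`. -/
noncomputable def optPerKey (f : ℝ) : ℝ := -Real.logb 2 f

/-- The space overhead of the Homogeneous Ribbon filter. -/
noncomputable def spaceOverhead (n m w r : ℕ) : ℝ :=
  spacePerKey n m r / optPerKey (fpRate n m w r) - 1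

/-- `r` is a closest integer to `x` (in case of a tie, both closest integers qualify). -/
def IsClosestInt (r : ℤ) (x : ℝ) : Prop := ∀ k : ℤ, |x - r| ≤ |x - k|

end Ribbon

/-! Given the hash values, a query is positive surely if its row lies in the span of the key rows,
and with probability exactly 2^(-r) otherwise. Hence f = 2^(-r) + (1 - 2^(-r)) p, where p =
`spanProb`, and everything reduces to showing p ≤ 2^(-r) ε/4.

If the query row is spanned, a minimal dependency through it covers an interval of l = hi - lo + w
columns without gaps (`exists_connected_dependency`). Every covered column receives a fresh random
bit, so a fixed set of rows is dependent in this way with probability at most 2^(-l). With N keys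
starting in [lo, hi], the union bound gives min(1, 2^(N-l)) ≤ exp(μ(N - l)) for 0 ≤ μ ≤ log 2.

Averaging over starting positions is a Chernoff bound: l exceeds the mean of N by a margin
proportional to ε, and a suitable μ bounds each term by exp(-(3/16)ε(w-1) - ε²t/8) with t = hi - lo
+ 1 (`exponent_le`). Geometric sums over lo and hi cost a factor O(ε^(-4)), which is polynomial in w
and is absorbed once εw is a large multiple of max(log w, r). -/

namespace Ribbon

/-! ### Reduction to the span probability -/

/-- The kernel of a surjective homomorphism to `H` has density `1 / |H|`. -/
lemma expect_eq_zero_of_surjective {G H : Type*} [AddCommGroup G] [Fintype G] [AddCommGroup H]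
    [Fintype H] [DecidableEq H] (f : G →+ H) (hf : Function.Surjective f) :
    𝔼 g : G, (if f g = 0 then (1 : ℝ) else 0) = ((Fintype.card H : ℝ))⁻¹ := by
  have hker : Nat.card f.ker * Fintype.card H = Fintype.card G := by
    have h1 := f.ker.card_mul_index
    rw [AddSubgroup.index_ker, AddMonoidHom.range_eq_top.2 hf, Nat.card_eq_fintype_card (α := G)] at h1
    rw [← h1, AddSubgroup.card_top, Nat.card_eq_fintype_card (α := H)]
  have hcard : (Finset.univ.filter fun g : G => f g = 0).card = Nat.card f.ker := by
    rw [Nat.card_eq_fintype_card, Fintype.card_subtype]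
    simp only [AddMonoidHom.mem_ker]
  rw [Fintype.expect_eq_sum_div_card, Finset.sum_boole, hcard, ← hker]
  have h0 : Nat.card f.ker ≠ 0 := Nat.card_pos.ne'
  push_cast
  field_simp

/-- For a fixed hash value, the query on a random solution is positive surely if the row of the
hash value is spanned by the rows of the keys, and with probability `2^(-r)` otherwise. -/
lemma expect_solutions_query {n m w : ℕ} (r : ℕ) (h : Fin n → HashValue m w) (a : HashValue m w)
    [Decidable (row a ∈ Submodule.span (ZMod 2) (Set.range fun i => row (h i)))] :
    𝔼 Z ∈ solutions r h, (if query a Z = 0 then (1 : ℝ) else 0) =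
      if row a ∈ Submodule.span (ZMod 2) (Set.range fun i => row (h i)) then 1
      else (1 / 2) ^ r := by
  have hzero : (0 : Matrix (Fin m) (Fin r) (ZMod 2)) ∈ solutions r h :=
    Finset.mem_filter.2 ⟨Finset.mem_univ _, fun x => Matrix.vecMul_zero _⟩
  split_ifs with hspan
  · rw [Finset.expect_congr rfl (g := fun _ => (1 : ℝ)), Finset.expect_const ⟨0, hzero⟩]
    intro Z hZ
    rw [if_pos]
    have hle : Submodule.span (ZMod 2) (Set.range fun i => row (h i)) ≤
        LinearMap.ker Z.vecMulLinear := by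
      rw [Submodule.span_le]
      rintro _ ⟨i, rfl⟩
      exact (Finset.mem_filter.1 hZ).2 i
    exact hle hspan
  · obtain ⟨φ, hφ, hker⟩ := Submodule.exists_le_ker_of_notMem hspan
    let G : AddSubgroup (Matrix (Fin m) (Fin r) (ZMod 2)) :=
      { carrier := {Z | ∀ x, query (h x) Z = 0}
        zero_mem' := fun x => by simp [query]
        add_mem' := fun {Y Z} hY hZ x => by
          have h1 := hY x
          have h2 := hZ x
          simp only [query] at *
          rw [Matrix.vecMul_add, h1, h2, add_zero]
        neg_mem' := fun {Y} hY x => by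
          have h1 := hY x
          simp only [query] at *
          rw [Matrix.vecMul_neg, h1, neg_zero] }
    let f : G →+ (Fin r → ZMod 2) :=
      { toFun := fun Z => query a Z.1
        map_zero' := by simp [query]
        map_add' := fun Y Z => by simp [query, Matrix.vecMul_add] }
    have hdot : ∀ v : Fin m → ZMod 2, v ⬝ᵥ (fun j => φ (Pi.single j 1)) = φ v := by
      intro v
      conv_rhs => rw [← Finset.univ_sum_single v, map_sum]
      refine Finset.sum_congr rfl fun j _ => ?_
      rw [← smul_eq_mul, ← map_smul, ← Pi.single_smul, smul_eq_mul, mul_one]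
    -- The functional φ kills the key rows but not `row a`. The rank-one matrix with column factor
    -- φ(e_j) answers a query b with φ(row b) times its row factor, so it is a solution, and scaling
    -- by φ(row a)⁻¹ hits any y.
    have hf : Function.Surjective f := by
      intro y
      have hq : ∀ b : HashValue m w,
          query b (Matrix.vecMulVec (fun j => φ (Pi.single j 1)) ((φ (row a))⁻¹ • y)) =
            (φ (row b) * (φ (row a))⁻¹) • y := by
        intro b
        rw [query, Matrix.vecMul_vecMulVec, hdot, smul_smul]
      refine ⟨⟨Matrix.vecMulVec (fun j => φ (Pi.single j 1)) ((φ (row a))⁻¹ • y),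
        fun x => ?_⟩, ?_⟩
      · rw [hq, LinearMap.mem_ker.1 (hker (Submodule.subset_span ⟨x, rfl⟩)), zero_mul, zero_smul]
      · exact (hq a).trans (by rw [mul_inv_cancel₀ hφ, one_smul])
    classical
    have key := expect_eq_zero_of_surjective f hf
    have hG : 𝔼 Z ∈ solutions r h, (if query a Z = 0 then (1 : ℝ) else 0) =
        𝔼 g : G, (if f g = 0 then (1 : ℝ) else 0) := by
      symm
      refine Finset.expect_bij (fun g _ => g.1) ?_ ?_ ?_ ?_
      · exact fun g _ => Finset.mem_filter.2 ⟨Finset.mem_univ _, g.2⟩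
      · exact fun g _ => rfl
      · exact fun g _ g' _ e => Subtype.ext e
      · exact fun Z hZ => ⟨⟨Z, (Finset.mem_filter.1 hZ).2⟩, Finset.mem_univ _, rfl⟩
    rw [hG, key]
    simp

open Classical in
/-- The probability that the row of a random hash value is spanned by the rows of the keys. -/
noncomputable def spanProb (n m w : ℕ) : ℝ :=
  𝔼 h : Fin n → HashValue m w, 𝔼 a : HashValue m w,
    if row a ∈ Submodule.span (ZMod 2) (Set.range fun i => row (h i)) then 1 else 0

lemma fpRate_eq {n m w : ℕ} (hwm : w ≤ m) (r : ℕ) :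
    fpRate n m w r = (1 / 2) ^ r + (1 - (1 / 2) ^ r) * spanProb n m w := by
  classical
  have : NeZero (m + 1 - w) := ⟨by omega⟩
  have hconst : (1 / 2 : ℝ) ^ r =
      𝔼 _h : Fin n → HashValue m w, 𝔼 _a : HashValue m w, (1 / 2 : ℝ) ^ r := by
    rw [Fintype.expect_const, Fintype.expect_const]
  rw [fpRate, spanProb, Finset.mul_expect]
  nth_rewrite 1 [hconst]
  rw [← Finset.expect_add_distrib]
  refine Finset.expect_congr rfl fun h _ => ?_
  simp only [fpRateOf]
  rw [Finset.expect_comm, Finset.mul_expect, ← Finset.expect_add_distrib]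
  refine Finset.expect_congr rfl fun a _ => ?_
  rw [expect_solutions_query]
  split_ifs <;> ring

lemma spanProb_nonneg (n m w : ℕ) : 0 ≤ spanProb n m w := by
  classical
  exact Finset.expect_nonneg fun h _ => Finset.expect_nonneg fun a _ => by split_ifs <;> norm_num

/-! ### Gap-free dependencies and their probability -/

lemma row_eq_zero {m w : ℕ} (a : HashValue m w) (j : Fin m)
    (h : ¬((a.1 : ℕ) ≤ j ∧ (j : ℕ) < a.1 + w)) : row a j = 0 := dif_neg h

/-- A linear dependency among rows through `o` contains one through `o` whose rows cover an
interval of columns without gaps. -/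
lemma exists_connected_dependency {ι : Type*} [Fintype ι] [DecidableEq ι] {m w : ℕ}
    (g : ι → HashValue m w) (o : ι) (S₀ : Finset ι) (ho : o ∈ S₀)
    (hS₀ : ∑ i ∈ S₀, row (g i) = 0) :
    ∃ S : Finset ι, o ∈ S ∧ ∑ i ∈ S, row (g i) = 0 ∧ ∃ lo hi : Fin (m + 1 - w),
      (∀ i ∈ S, lo ≤ (g i).1 ∧ (g i).1 ≤ hi) ∧
      ∀ j : Fin m, (lo : ℕ) ≤ j → (j : ℕ) < hi + w →
        ∃ i ∈ S, ((g i).1 : ℕ) ≤ j ∧ (j : ℕ) < (g i).1 + w := by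
  obtain ⟨S, hS, hmin⟩ := Finset.exists_min_image
    (Finset.univ.filter fun S : Finset ι => o ∈ S ∧ ∑ i ∈ S, row (g i) = 0) Finset.card
    ⟨S₀, by simp [ho, hS₀]⟩
  simp only [Finset.mem_filter, Finset.mem_univ, true_and] at hS hmin
  obtain ⟨i₁, hi₁, hlo⟩ := Finset.exists_min_image S (fun i => (g i).1) ⟨o, hS.1⟩
  obtain ⟨i₂, hi₂, hhi⟩ := Finset.exists_max_image S (fun i => (g i).1) ⟨o, hS.1⟩
  refine ⟨S, hS.1, hS.2, (g i₁).1, (g i₂).1, fun i hi => ⟨hlo i hi, hhi i hi⟩, ?_⟩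
  intro j hj₁ hj₂
  by_contra hgap
  push Not at hgap
  -- At an uncovered column j, the rows starting at or before j end before j, and the others start
  -- after it. The two supports are disjoint, so both parts sum to zero, and the one containing o
  -- contradicts minimality.
  set A := S.filter fun i => ((g i).1 : ℕ) ≤ j with hA
  set B := S.filter fun i => ¬((g i).1 : ℕ) ≤ j with hB
  have hAB : ∑ i ∈ A, row (g i) + ∑ i ∈ B, row (g i) = 0 := by
    rw [hA, hB, Finset.sum_filter_add_sum_filter_not, hS.2]
  have hA0 : ∀ k : Fin m, j ≤ k → (∑ i ∈ A, row (g i)) k = 0 := by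
    intro k hk
    rw [Finset.sum_apply]
    refine Finset.sum_eq_zero fun i hi => row_eq_zero _ _ ?_
    rw [hA, Finset.mem_filter] at hi
    have := hgap i hi.1 hi.2
    have hk' : (j : ℕ) ≤ k := hk
    omega
  have hB0 : ∀ k : Fin m, k ≤ j → (∑ i ∈ B, row (g i)) k = 0 := by
    intro k hk
    rw [Finset.sum_apply]
    refine Finset.sum_eq_zero fun i hi => row_eq_zero _ _ ?_
    rw [hB, Finset.mem_filter] at hi
    have hk' : (k : ℕ) ≤ j := hk
    omega
  have hAz : ∑ i ∈ A, row (g i) = 0 := by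
    funext k
    rcases le_total j k with hk | hk
    · exact hA0 k hk
    · have := congrFun hAB k
      rwa [Pi.add_apply, hB0 k hk, add_zero] at this
  have hBz : ∑ i ∈ B, row (g i) = 0 := by rwa [hAz, zero_add] at hAB
  have hi₁A : i₁ ∈ A := Finset.mem_filter.2 ⟨hi₁, hj₁⟩
  have hi₂B : i₂ ∈ B := Finset.mem_filter.2 ⟨hi₂, fun h => by
    have := hgap i₂ hi₂ h
    omega⟩
  have hcard : A.card + B.card = S.card := Finset.card_filter_add_card_filter_not _
  have hApos : 0 < A.card := Finset.card_pos.2 ⟨_, hi₁A⟩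
  have hBpos : 0 < B.card := Finset.card_pos.2 ⟨_, hi₂B⟩
  by_cases hoj : ((g o).1 : ℕ) ≤ j
  · have := hmin A ⟨Finset.mem_filter.2 ⟨hS.1, hoj⟩, hAz⟩
    omega
  · have := hmin B ⟨Finset.mem_filter.2 ⟨hS.1, hoj⟩, hBz⟩
    omega

/-- If the rows with indices in `S` cover the columns in `[lo, hi + w)`, then random coefficients
make them sum to zero with probability at most `2^(-(hi - lo + w))`. -/
lemma expect_sum_row_eq_zero_le {ι : Type*} [Fintype ι] [DecidableEq ι] {m w : ℕ}
    (s : ι → Fin (m + 1 - w)) (S : Finset ι) (lo hi : Fin (m + 1 - w)) (hlohi : lo ≤ hi)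
    (hcover : ∀ j : Fin m, (lo : ℕ) ≤ j → (j : ℕ) < hi + w →
        ∃ i ∈ S, (s i : ℕ) ≤ j ∧ (j : ℕ) < s i + w) :
    𝔼 c : ι → Fin w → ZMod 2,
      (if ∑ i ∈ S, row ((s i, c i) : HashValue m w) = 0 then (1 : ℝ) else 0) ≤
      ((2 : ℝ) ^ ((hi : ℕ) - lo + w))⁻¹ := by
  have hlt : ∀ b : Fin ((hi : ℕ) - lo + w), (lo : ℕ) + b < m := by
    intro b
    have h1 := b.2
    have h2 := hi.2
    have h3 : (lo : ℕ) ≤ hi := hlohi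
    omega
  let col : Fin ((hi : ℕ) - lo + w) → Fin m := fun b => ⟨lo + b, hlt b⟩
  have hcol : ∀ b, ∃ i ∈ S, (s i : ℕ) ≤ col b ∧ (col b : ℕ) < s i + w := by
    intro b
    refine hcover (col b) (Nat.le_add_right _ _) ?_
    have h1 := b.2
    have h3 : (lo : ℕ) ≤ hi := hlohi
    change (lo : ℕ) + b < hi + w
    omega
  choose k hkS hk₁ hk₂ using hcol
  let f : (ι → Fin w → ZMod 2) →+ (Fin ((hi : ℕ) - lo + w) → ZMod 2) :=
    { toFun := fun c b => ∑ i ∈ S, row ((s i, c i) : HashValue m w) (col b)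
      map_zero' := by
        funext b
        exact Finset.sum_eq_zero fun i _ => by simp [row]
      map_add' := fun c d => by
        funext b
        rw [Pi.add_apply, ← Finset.sum_add_distrib]
        refine Finset.sum_congr rfl fun i _ => ?_
        simp only [row, Pi.add_apply]
        split_ifs <;> simp }
  have hf : Function.Surjective f := by
    intro y
    -- Column b takes its bit from the chosen row `k b` alone: that coefficient is y b, and all
    -- other coefficients meeting the column are zero.
    refine ⟨fun i t => if h : (lo : ℕ) ≤ s i + t ∧ (s i : ℕ) + t - lo < (hi : ℕ) - lo + w then
      (if k ⟨s i + t - lo, h.2⟩ = i then y ⟨s i + t - lo, h.2⟩ else 0) else 0, ?_⟩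
    funext b
    change ∑ i ∈ S, row _ (col b) = y b
    rw [Finset.sum_eq_single_of_mem (k b) (hkS b)]
    · have hb : (s (k b) : ℕ) + (col b - s (k b)) - lo = b := by
        have h1 := hk₁ b
        have h2 : (col b : ℕ) = lo + b := rfl
        omega
      have hb' : (lo : ℕ) ≤ s (k b) + (col b - s (k b)) := by
        have h1 := hk₁ b
        have h2 : (col b : ℕ) = lo + b := rfl
        omega
      rw [row, dif_pos ⟨hk₁ b, hk₂ b⟩]
      simp only [hb, hb', b.2, true_and, dif_pos, Fin.eta, if_true]
    · intro i _ hne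
      by_cases hi' : (s i : ℕ) ≤ col b ∧ (col b : ℕ) < s i + w
      · have hb : (s i : ℕ) + (col b - s i) - lo = b := by
          have h2 : (col b : ℕ) = lo + b := rfl
          omega
        rw [row, dif_pos hi']
        simp only [hb, Fin.eta, if_neg hne.symm]
        simp
      · exact row_eq_zero _ _ hi'
  have key := expect_eq_zero_of_surjective f hf
  have hcard : (Fintype.card (Fin ((hi : ℕ) - lo + w) → ZMod 2) : ℝ) =
      (2 : ℝ) ^ ((hi : ℕ) - lo + w) := by simp
  rw [hcard] at key
  rw [← key]
  refine Finset.expect_le_expect fun c _ => ?_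
  split_ifs with h1 h2
  · exact le_rfl
  · refine absurd ?_ h2
    funext b
    have := congrFun h1 (col b)
    rwa [Finset.sum_apply] at this
  · norm_num
  · exact le_rfl


/-! ### Union bound for fixed starting positions -/

/-- Truncating a power of two at one only decreases it below any exponential of smaller rate. -/
lemma le_exp_of_le_one_of_le_two_pow {q μ : ℝ} {N l : ℕ} (hμ0 : 0 ≤ μ) (hμ : μ ≤ Real.log 2)
    (h1 : q ≤ 1) (h2 : q ≤ (2 : ℝ) ^ N * ((2 : ℝ) ^ l)⁻¹) :
    q ≤ Real.exp (μ * ((N : ℝ) - l)) := by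
  rcases le_total (l : ℝ) N with h | h
  · exact h1.trans (Real.one_le_exp (mul_nonneg hμ0 (by linarith)))
  · refine h2.trans ?_
    have hexp : ∀ k : ℕ, (2 : ℝ) ^ k = Real.exp (k * Real.log 2) := fun k => by
      rw [Real.exp_nat_mul, Real.exp_log two_pos]
    rw [hexp, hexp, ← Real.exp_neg, ← Real.exp_add, Real.exp_le_exp]
    nlinarith

/-- Over the two-element field a linear combination is a subset sum, and moving the query row to the
other side changes no sign. -/
lemma exists_insertNone_dependency {n m w : ℕ} (g : Option (Fin n) → HashValue m w)
    (hg : row (g none) ∈ Submodule.span (ZMod 2) (Set.range fun i => row (g (some i)))) :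
    ∃ S : Finset (Option (Fin n)), none ∈ S ∧ ∑ i ∈ S, row (g i) = 0 := by
  obtain ⟨c, hc⟩ := (Submodule.mem_span_range_iff_exists_fun _).1 hg
  refine ⟨Finset.insertNone (Finset.univ.filter fun i => c i = 1), Finset.none_mem_insertNone, ?_⟩
  rw [Finset.sum_insertNone, Finset.sum_filter, ← hc, ← Finset.sum_add_distrib]
  refine Finset.sum_eq_zero fun i _ => ?_
  have h01 : ∀ x : ZMod 2, x = 0 ∨ x = 1 := by decide
  rcases h01 (c i) with h | h
  · simp [h]
  · funext j
    simp [h, CharTwo.add_self_eq_zero]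

open Classical in
/-- For fixed starting positions, a union bound over the column intervals that a dependency of the
query row (index `none`) can cover. -/
lemma expect_coeff_mem_span_le {n m w : ℕ} (s : Option (Fin n) → Fin (m + 1 - w)) {μ : ℝ}
    (hμ0 : 0 ≤ μ) (hμ : μ ≤ Real.log 2) :
    𝔼 c : Option (Fin n) → Fin w → ZMod 2,
      (if row ((s none, c none) : HashValue m w) ∈ Submodule.span (ZMod 2)
        (Set.range fun i => row ((s (some i), c (some i)) : HashValue m w)) then (1 : ℝ) else 0) ≤
    ∑ lo ∈ Finset.Iic (s none), ∑ hi ∈ Finset.Ici (s none), Real.exp (μ *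
      (((Finset.univ.filter fun i => lo ≤ s (some i) ∧ s (some i) ≤ hi).card : ℝ) -
        ((hi : ℕ) - (lo : ℕ) + w : ℕ))) := by
  -- Only keys are counted: the query belongs to every dependency considered, so there are 2^|K|
  -- candidate sets.
  set K : Fin (m + 1 - w) → Fin (m + 1 - w) → Finset (Fin n) := fun lo hi =>
    Finset.univ.filter fun i => lo ≤ s (some i) ∧ s (some i) ≤ hi with hK
  let P : Fin (m + 1 - w) → Fin (m + 1 - w) → Finset (Fin n) →
      (Option (Fin n) → Fin w → ZMod 2) → Prop := fun lo hi S c =>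
    ∑ i ∈ Finset.insertNone S, row ((s i, c i) : HashValue m w) = 0 ∧
      ∀ j : Fin m, (lo : ℕ) ≤ j → (j : ℕ) < hi + w →
        ∃ i ∈ Finset.insertNone S, (s i : ℕ) ≤ j ∧ (j : ℕ) < s i + w
  have hP : ∀ c : Option (Fin n) → Fin w → ZMod 2,
      row ((s none, c none) : HashValue m w) ∈ Submodule.span (ZMod 2)
        (Set.range fun i => row ((s (some i), c (some i)) : HashValue m w)) →
      ∃ lo ∈ Finset.Iic (s none), ∃ hi ∈ Finset.Ici (s none), ∃ S ∈ (K lo hi).powerset,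
        P lo hi S c := by
    intro c hc
    obtain ⟨S₀, h0, hS₀⟩ := exists_insertNone_dependency (fun i => (s i, c i)) hc
    obtain ⟨S, hnone, hsum, lo, hi, hbd, hcov⟩ :=
      exists_connected_dependency (fun i => ((s i, c i) : HashValue m w)) none S₀ h0 hS₀
    have hS : Finset.insertNone (Finset.eraseNone S) = S := by
      rw [Finset.insertNone_eraseNone, Finset.insert_eq_of_mem hnone]
    refine ⟨lo, Finset.mem_Iic.2 (hbd _ hnone).1, hi, Finset.mem_Ici.2 (hbd _ hnone).2,
      Finset.eraseNone S, ?_, ?_⟩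
    · rw [Finset.mem_powerset]
      intro i hi
      rw [hK, Finset.mem_filter]
      exact ⟨Finset.mem_univ _, hbd _ (Finset.mem_eraseNone.1 hi)⟩
    · simp only [P]
      rw [hS]
      exact ⟨hsum, hcov⟩
  calc _ ≤ 𝔼 c : Option (Fin n) → Fin w → ZMod 2, ∑ lo ∈ Finset.Iic (s none),
        ∑ hi ∈ Finset.Ici (s none),
          (if ∃ S ∈ (K lo hi).powerset, P lo hi S c then (1 : ℝ) else 0) := by
        refine Finset.expect_le_expect fun c _ => ?_
        have h0 : ∀ lo hi, (0 : ℝ) ≤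
            if ∃ S ∈ (K lo hi).powerset, P lo hi S c then (1 : ℝ) else 0 := fun lo hi => by
          split_ifs <;> norm_num
        split_ifs with hc
        · obtain ⟨lo, hlo, hi, hhi, hS⟩ := hP c hc
          calc (1 : ℝ) = if ∃ S ∈ (K lo hi).powerset, P lo hi S c then (1 : ℝ) else 0 :=
                (if_pos hS).symm
            _ ≤ ∑ hi ∈ Finset.Ici (s none),
                  if ∃ S ∈ (K lo hi).powerset, P lo hi S c then (1 : ℝ) else 0 :=
                Finset.single_le_sum (f := fun hi =>
                  if ∃ S ∈ (K lo hi).powerset, P lo hi S c then (1 : ℝ) else 0)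
                  (fun hi _ => h0 lo hi) hhi
            _ ≤ _ := Finset.single_le_sum (f := fun lo => ∑ hi ∈ Finset.Ici (s none),
                  if ∃ S ∈ (K lo hi).powerset, P lo hi S c then (1 : ℝ) else 0)
                  (fun lo _ => Finset.sum_nonneg fun hi _ => h0 lo hi) hlo
        · exact Finset.sum_nonneg fun lo _ => Finset.sum_nonneg fun hi _ => h0 lo hi
    _ = ∑ lo ∈ Finset.Iic (s none), ∑ hi ∈ Finset.Ici (s none),
          𝔼 c : Option (Fin n) → Fin w → ZMod 2,
            (if ∃ S ∈ (K lo hi).powerset, P lo hi S c then (1 : ℝ) else 0) := by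
        rw [Finset.expect_sum_comm]
        refine Finset.sum_congr rfl fun lo _ => ?_
        rw [Finset.expect_sum_comm]
    _ ≤ _ := by
        refine Finset.sum_le_sum fun lo hlo => Finset.sum_le_sum fun hi hhi => ?_
        refine le_exp_of_le_one_of_le_two_pow hμ0 hμ ?_ ?_
        · calc _ ≤ 𝔼 c : Option (Fin n) → Fin w → ZMod 2, (1 : ℝ) :=
                Finset.expect_le_expect fun c _ => by split_ifs <;> norm_num
            _ = 1 := Fintype.expect_const _
        · calc _ ≤ 𝔼 c : Option (Fin n) → Fin w → ZMod 2, ∑ S ∈ (K lo hi).powerset,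
                  (if P lo hi S c then (1 : ℝ) else 0) := by
                refine Finset.expect_le_expect fun c _ => ?_
                split_ifs with h
                · obtain ⟨S, hS, hPS⟩ := h
                  calc (1 : ℝ) = if P lo hi S c then (1 : ℝ) else 0 := (if_pos hPS).symm
                    _ ≤ _ := Finset.single_le_sum (f := fun S =>
                        if P lo hi S c then (1 : ℝ) else 0)
                        (fun S _ => by split_ifs <;> norm_num) hS
                · exact Finset.sum_nonneg fun S _ => by split_ifs <;> norm_num
            _ = ∑ S ∈ (K lo hi).powerset, 𝔼 c : Option (Fin n) → Fin w → ZMod 2,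
                  (if P lo hi S c then (1 : ℝ) else 0) := Finset.expect_sum_comm _ _ _
            _ ≤ ∑ S ∈ (K lo hi).powerset, ((2 : ℝ) ^ ((hi : ℕ) - lo + w))⁻¹ := by
                refine Finset.sum_le_sum fun S _ => ?_
                -- Coverage depends only on the starting positions, which are fixed here; without it
                -- the event is empty.
                by_cases hcov : ∀ j : Fin m, (lo : ℕ) ≤ j → (j : ℕ) < hi + w →
                    ∃ i ∈ Finset.insertNone S, (s i : ℕ) ≤ j ∧ (j : ℕ) < s i + w
                · refine le_trans (le_of_eq ?_) (expect_sum_row_eq_zero_le s (Finset.insertNone S)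
                    lo hi ((Finset.mem_Iic.1 hlo).trans (Finset.mem_Ici.1 hhi)) hcov)
                  refine Finset.expect_congr rfl fun c _ => ?_
                  simp only [P, and_iff_left hcov]
                · rw [Finset.expect_eq_zero fun c _ => if_neg fun h => hcov h.2]
                  positivity
            _ = _ := by
                rw [Finset.sum_const, Finset.card_powerset, nsmul_eq_mul]
                push_cast
                rfl

/-! ### Chernoff bound for the load of an interval -/

/-- The left side is the moment generating function of a Bernoulli(x) variable. After centring, exp
y ≤ 1 + y + y² cancels the linear terms and leaves the variance x(1 - x). Its factor 1 - x is
essential in `exponent_le` for intervals filling almost the whole range. -/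
lemma one_add_mul_exp_sub_one_le {x μ : ℝ} (hx0 : 0 ≤ x) (hx1 : x ≤ 1) (hμ0 : 0 ≤ μ)
    (hμ1 : μ ≤ 1) :
    1 + x * (Real.exp μ - 1) ≤ Real.exp (μ * x + μ ^ 2 * (x * (1 - x))) := by
  have hquad : ∀ y : ℝ, |y| ≤ 1 → Real.exp y ≤ 1 + y + y ^ 2 := fun y hy => by
    have := (abs_le.1 (Real.abs_exp_sub_one_sub_id_le hy)).2
    linarith
  have h1 := hquad (μ * (1 - x)) (by
    rw [abs_of_nonneg (mul_nonneg hμ0 (by linarith))]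
    nlinarith)
  have h2 := hquad (-(μ * x)) (by
    rw [abs_neg, abs_of_nonneg (mul_nonneg hμ0 hx0)]
    nlinarith)
  have h3 : x * Real.exp (μ * (1 - x)) + (1 - x) * Real.exp (-(μ * x)) ≤
      Real.exp (μ ^ 2 * (x * (1 - x))) := by
    have h4 := Real.add_one_le_exp (μ ^ 2 * (x * (1 - x)))
    have h5 := mul_le_mul_of_nonneg_left h1 hx0
    have h6 := mul_le_mul_of_nonneg_left h2 (sub_nonneg.2 hx1)
    nlinarith
  have h7 := mul_le_mul_of_nonneg_left h3 (Real.exp_pos (μ * x)).le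
  rw [← Real.exp_add] at h7
  refine le_trans (le_of_eq ?_) h7
  have h8 : Real.exp μ = Real.exp (μ * x) * Real.exp (μ * (1 - x)) := by
    rw [← Real.exp_add]
    ring_nf
  have h9 : (1 : ℝ) = Real.exp (μ * x) * Real.exp (-(μ * x)) := by
    rw [← Real.exp_add, add_neg_cancel, Real.exp_zero]
  linear_combination x * h8 + (1 - x) * h9

/-- The moment generating function of the number of starting positions in an interval. -/
lemma expect_exp_card_le {n T : ℕ} [NeZero T] (lo hi : Fin T) (hlohi : lo ≤ hi) {μ x : ℝ}
    (hμ0 : 0 ≤ μ) (hμ1 : μ ≤ 1) (hx : x = ((hi : ℕ) - (lo : ℕ) + 1 : ℝ) / T) :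
    𝔼 s : Fin n → Fin T, Real.exp (μ *
      ((Finset.univ.filter fun i => lo ≤ s i ∧ s i ≤ hi).card : ℝ)) ≤
    Real.exp (n * (μ * x + μ ^ 2 * (x * (1 - x)))) := by
  have hT : (0 : ℝ) < T := by exact_mod_cast Nat.pos_of_ne_zero (NeZero.ne T)
  have hle : ((lo : ℕ) : ℝ) ≤ (hi : ℕ) := by exact_mod_cast hlohi
  have hx0 : 0 ≤ x := by
    rw [hx]
    exact div_nonneg (by linarith) hT.le
  have hx1 : x ≤ 1 := by
    rw [hx, div_le_one hT]
    have h1 : ((hi : ℕ) : ℝ) + 1 ≤ T := by exact_mod_cast hi.2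
    have h2 : (0 : ℝ) ≤ (lo : ℕ) := Nat.cast_nonneg _
    linarith
  have hsingle : 𝔼 t : Fin T, (if lo ≤ t ∧ t ≤ hi then Real.exp μ else 1) =
      1 + x * (Real.exp μ - 1) := by
    have hcard : ((Finset.univ.filter fun t : Fin T => lo ≤ t ∧ t ≤ hi).card : ℝ) =
        (hi : ℕ) - (lo : ℕ) + 1 := by
      have h1 : (Finset.univ.filter fun t : Fin T => lo ≤ t ∧ t ≤ hi) = Finset.Icc lo hi := by
        ext t
        simp
      have h2 : (lo : ℕ) ≤ hi := hlohi
      rw [h1, Fin.card_Icc, Nat.cast_sub (by omega)]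
      push_cast
      ring
    have hsum : ∀ t : Fin T, (if lo ≤ t ∧ t ≤ hi then Real.exp μ else 1) =
        1 + (if lo ≤ t ∧ t ≤ hi then (1 : ℝ) else 0) * (Real.exp μ - 1) := fun t => by
      split_ifs <;> ring
    rw [Fintype.expect_eq_sum_div_card, Finset.sum_congr rfl fun t _ => hsum t,
      Finset.sum_add_distrib, ← Finset.sum_mul, Finset.sum_boole, hcard, hx]
    simp only [Finset.sum_const, Finset.card_univ, Fintype.card_fin, nsmul_eq_mul, mul_one]
    field_simp
  have hprod : ∀ s : Fin n → Fin T, Real.exp (μ *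
      ((Finset.univ.filter fun i => lo ≤ s i ∧ s i ≤ hi).card : ℝ)) =
      ∏ i, (if lo ≤ s i ∧ s i ≤ hi then Real.exp μ else 1) := fun s => by
    rw [Finset.prod_ite, Finset.prod_const, Finset.prod_const_one, mul_one, mul_comm,
      Real.exp_nat_mul]
  rw [Finset.expect_congr rfl fun s _ => hprod s]
  have hpow := Finset.expect_pow Finset.univ
    (fun t : Fin T => if lo ≤ t ∧ t ≤ hi then Real.exp μ else 1) n
  rw [Fintype.piFinset_univ] at hpow
  rw [← hpow, hsingle, Real.exp_nat_mul]
  refine pow_le_pow_left₀ ?_ (one_add_mul_exp_sub_one_le hx0 hx1 hμ0 hμ1) n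
  have := Real.one_le_exp hμ0
  nlinarith

/-- The exponent in the union bound: a column interval with `t` starting positions is linearly less
loaded than its length, uniformly up to the boundary effects. -/
lemma exponent_le {ε μ x n w T t : ℝ} (hε0 : 0 < ε) (hw : 1 ≤ w) (hn : 0 < n) (hT : 0 < T)
    (hm : T + w - 1 = (1 + ε) * n) (hε1 : ε < 1 / 2) (ht : 0 ≤ t) (htT : t ≤ T)
    (hx : x = t / T) (hμ : μ = (ε + (w - 1) / n) / 4) :
    n * (μ * x + μ ^ 2 * (x * (1 - x))) - μ * (t + w - 1) ≤
      -(3 / 16 * ε * (w - 1)) - ε ^ 2 / 8 * t := by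
  obtain ⟨u, rfl⟩ : ∃ u, w = u + 1 := ⟨w - 1, by ring⟩
  have hu : 0 ≤ u := by linarith
  have hx0 : 0 ≤ x := hx ▸ div_nonneg ht hT.le
  have hx1 : x ≤ 1 := by rwa [hx, div_le_one hT]
  have htx : t = T * x := by rw [hx]; field_simp
  obtain ⟨v, hv⟩ : ∃ v, u = n * v := ⟨u / n, by field_simp⟩
  have hv0 : 0 ≤ v := by
    by_contra h
    push Not at h
    nlinarith
  have hμ' : μ = (ε + v) / 4 := by
    rw [hμ, hv]
    field_simp
    ring
  have hT' : T = (1 + ε - v) * n := by linarith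
  have hTn : t ≤ 3 / 2 * (n * x) := by
    rw [htx, hT']
    have : 0 ≤ n * x := by positivity
    nlinarith
  have hmain : n * (μ * x + μ ^ 2 * (x * (1 - x))) - μ * (t + (u + 1) - 1) ≤
      -(3 / 16 * ε * u) - 3 / 16 * ε ^ 2 * (n * x) := by
    -- With v = (w-1)/n, the interval length exceeds the mean load nx by n(v(1-x) + εx). The choice
    -- μ = (ε+v)/4 makes the quadratic term at most a quarter of the gain; the remaining 3/4 yields
    -- the factor 3/16.
    have hexp : n * (μ * x + μ ^ 2 * (x * (1 - x))) - μ * (t + (u + 1) - 1) =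
        n * (μ * (μ * (x * (1 - x))) - μ * (v * (1 - x) + ε * x)) := by
      rw [htx, hT', hv]
      ring
    have h1 : μ * (x * (1 - x)) ≤ (v * (1 - x) + ε * x) / 4 := by
      rw [hμ']
      have h2 : ε * x * x ≥ 0 := by positivity
      have h3 : v * (1 - x) * (1 - x) ≥ 0 := mul_nonneg (mul_nonneg hv0 (by linarith)) (by linarith)
      nlinarith
    have hμ0 : 0 ≤ μ := by rw [hμ']; positivity
    have h4 := mul_le_mul_of_nonneg_left h1 hμ0
    have h5 : μ * (v * (1 - x) + ε * x) ≥ (ε * v + ε ^ 2 * x) / 4 := by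
      rw [hμ']
      have : v * v * (1 - x) ≥ 0 := mul_nonneg (mul_nonneg hv0 hv0) (by linarith)
      nlinarith
    rw [hexp, hv]
    have h6 : μ * (μ * (x * (1 - x))) - μ * (v * (1 - x) + ε * x) ≤
        -(3 / 16) * (ε * v + ε ^ 2 * x) := by linarith
    have h7 := mul_le_mul_of_nonneg_left h6 hn.le
    linarith
  have h8 := mul_le_mul_of_nonneg_left hTn (sq_nonneg ε)
  linarith


/-! ### Averaging over starting positions and summing over intervals -/

lemma expect_option_pi {n : ℕ} {X : Type*} [Fintype X] (F : (Option (Fin n) → X) → ℝ)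
    (F' : X → (Fin n → X) → ℝ) (hF : ∀ g, F g = F' (g none) fun i => g (some i)) :
    𝔼 g : Option (Fin n) → X, F g = 𝔼 x : X, 𝔼 h : Fin n → X, F' x h := by
  rw [Fintype.expect_equiv (Equiv.piOptionEquivProd (β := fun _ : Option (Fin n) => X)) F
    (fun p => F' p.1 p.2) hF, ← Finset.univ_product_univ, Finset.expect_product]

lemma expect_arrow_prod {ι X Y : Type*} [Fintype ι] [DecidableEq ι] [Fintype X] [Fintype Y]
    (F : (ι → X × Y) → ℝ) :
    𝔼 g : ι → X × Y, F g = 𝔼 s : ι → X, 𝔼 c : ι → Y, F fun i => (s i, c i) := by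
  rw [Fintype.expect_equiv (Equiv.arrowProdEquivProdArrow ι (fun _ => X) (fun _ => Y)) F
    (fun p => F fun i => (p.1 i, p.2 i)) fun g => rfl, ← Finset.univ_product_univ,
    Finset.expect_product]

lemma sum_pow_le_of_injOn {ι : Type*} (s : Finset ι) (g : ι → ℕ) (hg : Set.InjOn g s) {q : ℝ}
    (hq0 : 0 ≤ q) (hq1 : q < 1) : ∑ i ∈ s, q ^ g i ≤ (1 - q)⁻¹ := by
  classical
  rw [← Finset.sum_image (f := fun k => q ^ k) hg, ← tsum_geometric_of_lt_one hq0 hq1]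
  exact (summable_geometric_of_lt_one hq0 hq1).sum_le_tsum _ fun k _ => pow_nonneg hq0 k

/-- Splitting hi - lo at b factors the double sum into two geometric series, each at most 1/(1 -
exp(-B)) ≤ 2/B. -/
lemma sum_interval_le {T : ℕ} (b : Fin T) {B : ℝ} (hB0 : 0 < B) (hB1 : B ≤ 1 / 2) :
    ∑ lo ∈ Finset.Iic b, ∑ hi ∈ Finset.Ici b, Real.exp (-(B * ((hi : ℕ) - (lo : ℕ) + 1 : ℝ))) ≤
      (2 / B) ^ 2 := by
  set q := Real.exp (-B) with hq
  have hq0 : 0 ≤ q := (Real.exp_pos _).le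
  have hqB : B / 2 ≤ 1 - q := by
    have := (abs_le.1 (Real.abs_exp_sub_one_sub_id_le (x := -B)
      (by rw [abs_neg, abs_of_pos hB0]; linarith))).2
    nlinarith
  have hq1 : q < 1 := by linarith
  have hinv : (1 - q)⁻¹ ≤ 2 / B := by
    rw [← inv_div]
    exact inv_anti₀ (by linarith) hqB
  have hlo : ∑ lo ∈ Finset.Iic b, q ^ ((b : ℕ) - lo) ≤ (1 - q)⁻¹ := by
    refine sum_pow_le_of_injOn _ (fun lo : Fin T => (b : ℕ) - lo) ?_ hq0 hq1
    intro i hi j hj hij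
    have h1 : i ≤ b := by simpa using hi
    have h2 : j ≤ b := by simpa using hj
    simp only at hij
    ext
    omega
  have hhi : ∑ hi ∈ Finset.Ici b, q ^ ((hi : ℕ) - b) ≤ (1 - q)⁻¹ := by
    refine sum_pow_le_of_injOn _ (fun hi : Fin T => (hi : ℕ) - b) ?_ hq0 hq1
    intro i hi j hj hij
    have h1 : b ≤ i := by simpa using hi
    have h2 : b ≤ j := by simpa using hj
    simp only at hij
    ext
    omega
  calc _ ≤ ∑ lo ∈ Finset.Iic b, ∑ hi ∈ Finset.Ici b, q ^ ((b : ℕ) - lo) * q ^ ((hi : ℕ) - b) := by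
        refine Finset.sum_le_sum fun lo hlo => Finset.sum_le_sum fun hi hhi => ?_
        have h1 : (lo : ℕ) ≤ b := Fin.le_def.1 (Finset.mem_Iic.1 hlo)
        have h2 : (b : ℕ) ≤ hi := Fin.le_def.1 (Finset.mem_Ici.1 hhi)
        rw [hq, ← Real.exp_nat_mul, ← Real.exp_nat_mul, ← Real.exp_add, Real.exp_le_exp,
          Nat.cast_sub h1, Nat.cast_sub h2]
        linarith
    _ = (∑ lo ∈ Finset.Iic b, q ^ ((b : ℕ) - lo)) * ∑ hi ∈ Finset.Ici b, q ^ ((hi : ℕ) - b) := by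
        rw [Finset.sum_mul_sum]
    _ ≤ (2 / B) * (2 / B) := by
        refine mul_le_mul (hlo.trans hinv) (hhi.trans hinv)
          (Finset.sum_nonneg fun _ _ => pow_nonneg hq0 _) (by positivity)
    _ = _ := (sq _).symm

lemma spanProb_le {n m w : ℕ} {ε : ℝ} (hε0 : 0 < ε) (hε1 : ε < 1 / 2) (hw : 1 ≤ w) (hwm : w ≤ m)
    (hm : (m : ℝ) = (1 + ε) * n) :
    spanProb n m w ≤ 256 / ε ^ 4 * Real.exp (-(3 / 16 * ε * ((w : ℝ) - 1))) := by
  classical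
  have hT : NeZero (m + 1 - w) := ⟨by omega⟩
  have hw' : (1 : ℝ) ≤ w := by exact_mod_cast hw
  have hwm' : (w : ℝ) ≤ m := by exact_mod_cast hwm
  have hn : (0 : ℝ) < n := by
    by_contra h
    push Not at h
    nlinarith
  have hTm : ((m + 1 - w : ℕ) : ℝ) = m + 1 - w := by
    rw [Nat.cast_sub (by omega)]
    push_cast
    ring
  have hTpos : (0 : ℝ) < ((m + 1 - w : ℕ) : ℝ) := by rw [hTm]; linarith
  set μ : ℝ := (ε + ((w : ℝ) - 1) / n) / 4 with hμdef
  have hμ0 : 0 ≤ μ := by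
    have : 0 ≤ ((w : ℝ) - 1) / n := div_nonneg (by linarith) hn.le
    linarith
  have hμ2 : μ ≤ 1 / 2 := by
    -- From w ≤ m = (1+ε)n; this keeps μ within the ranges of both exponential estimates.
    have : ((w : ℝ) - 1) / n ≤ 3 / 2 := by
      rw [div_le_iff₀ hn]
      nlinarith
    linarith
  have hlog : μ ≤ Real.log 2 := by linarith [Real.log_two_gt_d9]
  let ind : (Option (Fin n) → HashValue m w) → ℝ := fun g =>
    if row (g none) ∈ Submodule.span (ZMod 2) (Set.range fun i => row (g (some i))) then 1 else 0
  let W : Fin (m + 1 - w) → (Fin n → Fin (m + 1 - w)) → ℝ := fun b s =>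
    ∑ lo ∈ Finset.Iic b, ∑ hi ∈ Finset.Ici b, Real.exp (μ *
      (((Finset.univ.filter fun i => lo ≤ s i ∧ s i ≤ hi).card : ℝ) -
        ((hi : ℕ) - (lo : ℕ) + w : ℕ)))
  have hspan : spanProb n m w = 𝔼 g, ind g := by
    rw [spanProb, Finset.expect_comm, expect_option_pi ind (fun a h =>
      if row a ∈ Submodule.span (ZMod 2) (Set.range fun i => row (h i)) then 1 else 0) fun g => rfl]
  have hb : ∀ b : Fin (m + 1 - w), 𝔼 s : Fin n → Fin (m + 1 - w), W b s ≤
      256 / ε ^ 4 * Real.exp (-(3 / 16 * ε * ((w : ℝ) - 1))) := by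
    intro b
    calc 𝔼 s : Fin n → Fin (m + 1 - w), W b s
        = ∑ lo ∈ Finset.Iic b, ∑ hi ∈ Finset.Ici b, 𝔼 s : Fin n → Fin (m + 1 - w),
            Real.exp (μ * (((Finset.univ.filter fun i => lo ≤ s i ∧ s i ≤ hi).card : ℝ) -
              ((hi : ℕ) - (lo : ℕ) + w : ℕ))) := by
          simp only [W]
          rw [Finset.expect_sum_comm]
          exact Finset.sum_congr rfl fun lo _ => Finset.expect_sum_comm _ _ _
      _ ≤ ∑ lo ∈ Finset.Iic b, ∑ hi ∈ Finset.Ici b,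
            Real.exp (-(3 / 16 * ε * ((w : ℝ) - 1))) *
              Real.exp (-(ε ^ 2 / 8 * ((hi : ℕ) - (lo : ℕ) + 1 : ℝ))) := by
          refine Finset.sum_le_sum fun lo hlo => Finset.sum_le_sum fun hi hhi => ?_
          have hlohi : lo ≤ hi := (Finset.mem_Iic.1 hlo).trans (Finset.mem_Ici.1 hhi)
          have hlohi' : (lo : ℕ) ≤ hi := hlohi
          have hlohiR : ((lo : ℕ) : ℝ) ≤ (hi : ℕ) := by exact_mod_cast hlohi'
          have hhiT : ((hi : ℕ) : ℝ) + 1 ≤ ((m + 1 - w : ℕ) : ℝ) := by exact_mod_cast hi.2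
          have hlo0 : (0 : ℝ) ≤ (lo : ℕ) := Nat.cast_nonneg _
          set t : ℝ := (hi : ℕ) - (lo : ℕ) + 1 with ht
          have hl : (((hi : ℕ) - (lo : ℕ) + w : ℕ) : ℝ) = t + w - 1 := by
            rw [Nat.cast_add, Nat.cast_sub hlohi', ht]
            ring
          have hmgf := expect_exp_card_le (n := n) lo hi hlohi hμ0 (by linarith : μ ≤ 1) rfl
          have hexp := exponent_le (t := t) hε0 hw' hn hTpos (by rw [hTm]; linarith) hε1
            (by linarith) (by linarith) rfl hμdef
          have hsplit : ∀ s : Fin n → Fin (m + 1 - w),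
              Real.exp (μ * (((Finset.univ.filter fun i => lo ≤ s i ∧ s i ≤ hi).card : ℝ) -
                ((hi : ℕ) - (lo : ℕ) + w : ℕ))) =
              Real.exp (μ * ((Finset.univ.filter fun i => lo ≤ s i ∧ s i ≤ hi).card : ℝ)) *
                Real.exp (-(μ * (t + w - 1))) := fun s => by
            rw [hl, ← Real.exp_add]
            ring_nf
          rw [Finset.expect_congr rfl fun s _ => hsplit s, ← Finset.expect_mul]
          refine (mul_le_mul_of_nonneg_right hmgf (Real.exp_pos _).le).trans ?_
          rw [← Real.exp_add, ← Real.exp_add, Real.exp_le_exp]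
          linarith
      _ = Real.exp (-(3 / 16 * ε * ((w : ℝ) - 1))) *
            ∑ lo ∈ Finset.Iic b, ∑ hi ∈ Finset.Ici b,
              Real.exp (-(ε ^ 2 / 8 * ((hi : ℕ) - (lo : ℕ) + 1 : ℝ))) := by
          simp only [Finset.mul_sum]
      _ ≤ Real.exp (-(3 / 16 * ε * ((w : ℝ) - 1))) * (2 / (ε ^ 2 / 8)) ^ 2 :=
          mul_le_mul_of_nonneg_left (sum_interval_le b (by positivity) (by nlinarith))
            (Real.exp_pos _).le
      _ = _ := by
          field_simp
          norm_num
  calc spanProb n m w = 𝔼 s : Option (Fin n) → Fin (m + 1 - w),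
        𝔼 c : Option (Fin n) → Fin w → ZMod 2, ind fun i => (s i, c i) := by
        rw [hspan, expect_arrow_prod]
    _ ≤ 𝔼 s : Option (Fin n) → Fin (m + 1 - w), W (s none) fun i => s (some i) :=
        Finset.expect_le_expect fun s _ => expect_coeff_mem_span_le s hμ0 hlog
    _ = 𝔼 b : Fin (m + 1 - w), 𝔼 s : Fin n → Fin (m + 1 - w), W b s :=
        expect_option_pi _ W fun _ => rfl
    _ ≤ 𝔼 _b : Fin (m + 1 - w), 256 / ε ^ 4 * Real.exp (-(3 / 16 * ε * ((w : ℝ) - 1))) :=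
        Finset.expect_le_expect fun b _ => hb b
    _ = _ := Fintype.expect_const _

/-- Since 1/ε ≤ w, the prefactor is at most 256 w⁴. The hypothesis gives (3/16)εw > 60 max(log w,
r), ample for a decay of w^(-7) 2^(-r); of the remaining 256/w³, one factor 1/w ≤ ε supplies the ε
and w ≥ 640 the constant. -/
lemma spanProb_le_of_large {n m w r : ℕ} {ε : ℝ} (hε0 : 0 < ε) (hε1 : ε < 1 / 2) (hr : 1 ≤ r)
    (hC : 320 * max (Real.log (w : ℝ)) (r : ℝ) < ε * (w : ℝ)) (hwm : w ≤ m)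
    (hm : (m : ℝ) = (1 + ε) * n) :
    spanProb n m w ≤ (1 / 2) ^ r * (ε / 4) := by
  have hr' : (1 : ℝ) ≤ r := by exact_mod_cast hr
  have hlogC : 320 * Real.log w < ε * w :=
    lt_of_le_of_lt (mul_le_mul_of_nonneg_left (le_max_left _ _) (by norm_num)) hC
  have hrC : 320 * (r : ℝ) < ε * w :=
    lt_of_le_of_lt (mul_le_mul_of_nonneg_left (le_max_right _ _) (by norm_num)) hC
  have hw640 : (640 : ℝ) ≤ w := by nlinarith [Nat.cast_nonneg (α := ℝ) w]
  have hw0 : (0 : ℝ) < w := by linarith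
  have hw1 : 1 ≤ w := by
    have : (1 : ℝ) ≤ w := by linarith
    exact_mod_cast this
  refine (spanProb_le hε0 hε1 hw1 hwm hm).trans ?_
  have hεw : 1 / ε ≤ w := by
    rw [div_le_iff₀ hε0]
    linarith
  have hexp : Real.exp (-(3 / 16 * ε * ((w : ℝ) - 1))) ≤ ((w : ℝ) ^ 7)⁻¹ * (1 / 2) ^ r := by
    have h1 : ((w : ℝ) ^ 7)⁻¹ = Real.exp (-(7 * Real.log w)) := by
      rw [Real.exp_neg]
      congr 1
      have := Real.exp_nat_mul (Real.log w) 7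
      rw [Real.exp_log hw0] at this
      exact_mod_cast this.symm
    have h2 : Real.exp (-(r : ℝ)) ≤ (1 / 2) ^ r := by
      rw [one_div, inv_pow, Real.exp_neg]
      refine inv_anti₀ (by positivity) ?_
      have h3 : (2 : ℝ) ≤ Real.exp 1 := by linarith [Real.add_one_le_exp (1 : ℝ)]
      have h4 := pow_le_pow_left₀ (by norm_num) h3 r
      rwa [← Real.exp_nat_mul, mul_one] at h4
    rw [h1]
    refine le_trans ?_ (mul_le_mul_of_nonneg_left h2 (Real.exp_pos _).le)
    rw [← Real.exp_add, Real.exp_le_exp]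
    linarith
  have hε4 : 256 / ε ^ 4 ≤ 256 * (w : ℝ) ^ 4 := by
    have := pow_le_pow_left₀ (by positivity) hεw 4
    rw [div_pow, one_pow] at this
    rw [div_eq_mul_one_div]
    linarith
  calc _ ≤ 256 * (w : ℝ) ^ 4 * (((w : ℝ) ^ 7)⁻¹ * (1 / 2) ^ r) :=
        mul_le_mul hε4 hexp (Real.exp_pos _).le (by positivity)
    _ = (1 / 2) ^ r * (256 / (w : ℝ) ^ 2 * (1 / w)) := by
        field_simp
    _ ≤ (1 / 2) ^ r * (1 / 4 * ε) := by
        refine mul_le_mul_of_nonneg_left (mul_le_mul ?_ ?_ (by positivity) (by norm_num))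
          (by positivity)
        · rw [div_le_iff₀ (by positivity)]
          nlinarith
        · rw [one_div_le hw0 hε0]
          exact hεw
    _ = _ := by ring

/-! ### Rounding, space overhead and conclusion -/

/-- Comparison with r ± 1 puts log₂ φ within 1/2 of -r, so 2^(-r) is within a factor √2 of φ. The
slack 9/8 ≤ √2 leaves room for the factor 1 + ε/4 < 9/8 in the upper bound on f. -/
lemma IsClosestInt.bounds {φ : ℝ} (hφ : 0 < φ) {r : ℕ}
    (hr : IsClosestInt (r : ℤ) (-Real.logb 2 φ)) :
    φ / 2 ≤ (1 / 2) ^ r ∧ 9 / 8 * (1 / 2) ^ r ≤ 2 * φ := by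
  have h1 := hr (r + 1)
  have h2 := hr (r - 1)
  push_cast at h1 h2
  have hφ' : φ = (2 : ℝ) ^ Real.logb 2 φ := (Real.rpow_logb two_pos (by norm_num) hφ).symm
  have hhalf : (1 / 2 : ℝ) ^ r = (2 : ℝ) ^ (-(r : ℝ)) := by
    rw [Real.rpow_neg two_pos.le, Real.rpow_natCast, one_div, inv_pow]
  set y := Real.logb 2 φ with hy
  have hu : y ≤ -r + 1 / 2 := by
    by_contra h
    push Not at h
    rw [abs_of_neg (by linarith), le_abs] at h2
    rcases h2 with h2 | h2 <;> linarith
  have hl : -r - 1 / 2 ≤ y := by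
    by_contra h
    push Not at h
    rw [abs_of_pos (by linarith), le_abs] at h1
    rcases h1 with h1 | h1 <;> linarith
  rw [hφ', hhalf]
  constructor
  · rw [div_le_iff₀ two_pos]
    calc (2 : ℝ) ^ y ≤ (2 : ℝ) ^ (-(r : ℝ) + 1) :=
          Real.rpow_le_rpow_of_exponent_le one_le_two (by linarith)
      _ = _ := by rw [Real.rpow_add two_pos, Real.rpow_one]
  · calc 9 / 8 * (2 : ℝ) ^ (-(r : ℝ)) ≤ (2 : ℝ) ^ (1 / 2 : ℝ) * (2 : ℝ) ^ (-(r : ℝ)) := by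
          refine mul_le_mul_of_nonneg_right ?_ (by positivity)
          rw [← Real.sqrt_eq_rpow]
          exact Real.le_sqrt_of_sq_le (by norm_num)
      _ = (2 : ℝ) ^ (1 / 2 + -(r : ℝ)) := (Real.rpow_add two_pos _ _).symm
      _ ≤ (2 : ℝ) ^ (1 + y) := Real.rpow_le_rpow_of_exponent_le one_le_two (by linarith)
      _ = _ := by rw [Real.rpow_add two_pos, Real.rpow_one]

lemma le_optPerKey {f ε : ℝ} {r : ℕ} (hf : 0 < f) (hε : 0 < ε)
    (hle : f ≤ (1 / 2) ^ r * (1 + ε / 4)) : r - 2 / 5 * ε ≤ optPerKey f := by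
  have hlog2 := Real.log_two_gt_d9
  have h1 : Real.log f ≤ -(r * Real.log 2) + ε / 4 := by
    calc Real.log f ≤ Real.log ((1 / 2) ^ r * (1 + ε / 4)) := Real.log_le_log hf hle
      _ = -(r * Real.log 2) + Real.log (1 + ε / 4) := by
          rw [Real.log_mul (by positivity) (by positivity), Real.log_pow, one_div, Real.log_inv]
          ring
      _ ≤ _ := by
          have := Real.log_le_sub_one_of_pos (show 0 < 1 + ε / 4 by positivity)
          linarith
  -- The constant 2/5 comes from (1/4)/log 2 < 2/5.
  rw [optPerKey, Real.logb, le_neg, div_le_iff₀ (by linarith)]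
  nlinarith

end Ribbon

theorem mainTheorem1 :
    ∃ C : ℝ, 0 < C ∧
      ∀ (ε : ℝ), ε < 1 / 2 →
      ∀ (φ : ℝ), 0 < φ →
      ∀ (r : ℕ), Ribbon.IsClosestInt (r : ℤ) (-Real.logb 2 φ) →
      ∀ (w : ℕ), C * max (Real.log (w : ℝ)) (r : ℝ) < ε * (w : ℝ) →
      ∀ (n m : ℕ), (m : ℝ) = (1 + ε) * (n : ℝ) → w ≤ m →
        Ribbon.fpRate n m w r ∈ Set.Icc (φ / 2) (2 * φ) ∧
        (1 ≤ r →
          0 < Ribbon.optPerKey (Ribbon.fpRate n m w r) ∧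
          Ribbon.spaceOverhead n m w r ≤ 2 * ε) := by
  refine ⟨320, by norm_num, fun ε hε1 φ hφ r hr w hC n m hm hwm => ?_⟩
  obtain ⟨hlow, hupp⟩ := hr.bounds hφ
  have hεw : 0 < ε * w := by
    refine lt_of_le_of_lt ?_ hC
    exact mul_nonneg (by norm_num) (le_max_of_le_right (Nat.cast_nonneg r))
  have hw0 : (0 : ℝ) < w := by
    rcases (Nat.cast_nonneg (α := ℝ) w).lt_or_eq with h | h
    · exact h
    · rw [← h, mul_zero] at hεw
      exact absurd hεw (lt_irrefl _)
  have hε0 : 0 < ε := (mul_pos_iff_of_pos_right hw0).1 hεw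
  have hf := Ribbon.fpRate_eq (n := n) hwm r
  have hp0 := Ribbon.spanProb_nonneg n m w
  have hpow0 : (0 : ℝ) < (1 / 2) ^ r := by positivity
  have hpow1 : (1 / 2 : ℝ) ^ r ≤ 1 := pow_le_one₀ (by norm_num) (by norm_num)
  have hfl : (1 / 2) ^ r ≤ Ribbon.fpRate n m w r := by
    rw [hf]
    have := mul_nonneg (sub_nonneg.2 hpow1) hp0
    linarith
  rcases Nat.eq_zero_or_pos r with rfl | hr1
  · refine ⟨⟨hlow.trans hfl, ?_⟩, fun h => absurd h (by norm_num)⟩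
    rw [hf]
    simp only [pow_zero, sub_self, zero_mul, add_zero, mul_one] at hupp ⊢
    linarith
  · have hp := Ribbon.spanProb_le_of_large hε0 hε1 hr1 hC hwm hm
    have hfu : Ribbon.fpRate n m w r ≤ (1 / 2) ^ r * (1 + ε / 4) := by
      rw [hf]
      nlinarith
    refine ⟨⟨hlow.trans hfl, ?_⟩, fun _ => ?_⟩
    · refine hfu.trans (le_trans ?_ hupp)
      nlinarith
    · have hopt := Ribbon.le_optPerKey (hpow0.trans_le hfl) hε0 hfu
      have hr' : (1 : ℝ) ≤ r := by exact_mod_cast hr1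
      have hopt0 : 0 < Ribbon.optPerKey (Ribbon.fpRate n m w r) := by linarith
      have hn : (0 : ℝ) < n := by
        have : (w : ℝ) ≤ m := by exact_mod_cast hwm
        by_contra h
        push Not at h
        nlinarith
      refine ⟨hopt0, ?_⟩
      rw [Ribbon.spaceOverhead, Ribbon.spacePerKey, sub_le_iff_le_add, div_le_iff₀ hopt0,
        div_le_iff₀ hn, hm]
      -- One ε is the cost of m/n = 1 + ε; the other pays for the loss in opt, as (2/5)(1 + 2ε) <
      -- 4/5 < r.
      have h1 : (1 + ε) * r ≤ (2 * ε + 1) * (r - 2 / 5 * ε) := by nlinarith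
      have h2 := mul_le_mul_of_nonneg_left hopt (by linarith : 0 ≤ 2 * ε + 1)
      have h3 := mul_le_mul_of_nonneg_right (h1.trans h2) hn.le
      linarith
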